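/- Let $q$ be a Borel probability measure on $\mathbb R$ with finite second moment, with distribution function $F_q(x)=q((-\infty,x])$, quantile function $F_q^{-1}(y)=\min\{x: F_q(x)\ge y\}$ ($0<y<1$), and mean $\mu_q=\int x\,dq(x)$. For probability measures $\xi,\nu$ on $\mathbb R$ let $W_2^2(\xi,\nu)=\inf_\pi\int (x-z)^2\,d\pi(x,z)$, the infimum being over all measures $\pi$ on $\mathbb R^2$ with marginals $\xi$ and $\nu$. Let $\mathrm{erf}(x)=\frac{2}{\sqrt\pi}\int_0^x e^{-t^2}\,dt$, with inverse $\mathrm{erf}^{-1}:(-1,1)\to\mathbb R$, extended by $\mathrm{erf}^{-1}(\pm1)=\pm\infty$ (so that $e^{-[\mathrm{erf}^{-1}(\pm 1)]^2}=0$). For $\sigma=0$ let $\mathcal N(\mu,0)$ be the point mass at $\mu$. Then: 1. (Quantile matching.) For all $\mu\in\mathbb R$, $\sigma\ge 0$, the quantile function of $\mathcal N(\mu,\sigma^2)$ is $y\mapsto\mu+\sqrt2\,\sigma\,\mathrm{erf}^{-1}(2y-1)$ on $(0,1)$, and $W_2^2(q,\mathcal N(\mu,\sigma^2))=\int_0^1\big(F_q^{-1}(y)-F_{\mathcal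 N(\mu,\sigma^2)}^{-1}(y)\big)^2\,dy<\infty$. 2. The following two integrals converge absolutely, and their normalisations agree and are nonnegative: $$\sigma^\star:=\sqrt2\int_0^1F_q^{-1}(y)\,\mathrm{erf}^{-1}(2y-1)\,dy=\frac1{\sqrt{2\pi}}\int_{-\infty}^{\infty}e^{-[\mathrm{erf}^{-1}(2F_q(f)-1)]^2}\,df .$$ 3. Over all $\mu\in\mathbb R$ and $\sigma\ge0$, $W_2^2(q,\mathcal N(\mu,\sigma^2))$ is minimised exactly at $(\mu,\sigma)=(\mu_q,\sigma^\star)$. If $q$ is not a point mass, then $\sigma^\star>0$, and $(\mu_q,\sigma^\star)$ is also the only minimiser over $\mu\in\mathbb R$ and $\sigma>0$. 4. (Comparison with expectation propagation, EP.) If the Kullback–Leibler divergence $\mathrm{KL}(q\,\|\,\mathcal N(\mu,\sigma^2))$ is finite for some $\mu\in\mathbb R$, $\sigma>0$, then a pair $(\mu,\sigma)$ with $\sigma>0$ minimises it over $\mathbb R\times(0,\infty)$ if and only if $\mu=\mu_q$ and $\sigma^2$ is the variance of $q$. Thus the mean is the same as that of the $W_2$ minimiser, while EP matches moments instead of quantile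 functions. -/

import Mathlib

open MeasureTheory ProbabilityTheory Set
open scoped NNReal ENNReal

noncomputable section

namespace QP

/-- The couplings of two measures on the line: the measures on the plane whose marginals are
`ξ` and `ν`. -/
def couplings (ξ ν : Measure ℝ) : Set (Measure (ℝ × ℝ)) :=
  {π | π.map Prod.fst = ξ ∧ π.map Prod.snd = ν}

/-- The squared `L₂` Wasserstein distance of two measures on the line, as an element of
`[0, ∞]`. -/
def wassersteinSq (ξ ν : Measure ℝ) : ℝ≥0∞ :=
  ⨅ π ∈ couplings ξ ν, ∫⁻ z : ℝ × ℝ, ENNReal.ofReal ((z.1 - z.2) ^ 2) ∂π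

/-- The quantile function `F⁻¹(y) = min {x : F(x) ≥ y}` of a probability measure on the line.
For `0 < y < 1` the set is nonempty, closed and bounded below, so that the infimum is a minimum;
the values at other `y` are never used (the end points are negligible under `∫₀¹`). -/
def quantile (ν : Measure ℝ) (y : ℝ) : ℝ := sInf {x : ℝ | y ≤ cdf ν x}

/-- The error function. -/
def erf (x : ℝ) : ℝ := 2 / Real.sqrt Real.pi * ∫ t in (0 : ℝ)..x, Real.exp (-t ^ 2)

/-- The inverse of `erf`, meaningful on `(-1, 1)`, the range of `erf`. -/
def erfInv (u : ℝ) : ℝ := Function.invFun erf u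

/-- The inverse of `erf` on `[-1, 1]`, with the usual values `erf⁻¹(-1) = -∞` and
`erf⁻¹(1) = +∞` at the end points. -/
def erfInvExt (u : ℝ) : EReal :=
  if u ≤ -1 then ⊥ else if 1 ≤ u then ⊤ else (erfInv u : EReal)

/-- `exp (-[erf⁻¹(u)]²)` for `u ∈ [-1, 1]`, computed in the extended reals, so that it is `0`
at `u = -1` and at `u = 1`. -/
def expNegErfInvSq (u : ℝ) : ℝ := (EReal.exp (-((erfInvExt u) ^ 2))).toReal

end QP

end

namespace QP

/-! In dimension one the monotone coupling `y ↦ (quantile ξ y, quantile ν y)` of the uniform law is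
optimal. By Tonelli, the quadratic cost of any coupling is an integral of the masses it carries
across intervals (`lintegral_sq_sub_eq`). The two marginals alone bound each such mass from below
(`ofReal_cdf_sub_le`), and the monotone coupling attains every bound (`map_quantile_prodMk_apply`).

Gaussian quantiles are affine in `erfInv (2 * y - 1)`, which has mean `0` and second moment `1 / 2`
under the uniform law. Hence `W₂²` is a constant plus `(m - mean)² + (s - quantileSigma q)²`
(`integral_sq_quantile_sub_gaussianReal`), and the minimiser can be read off. The second formula for
the optimal `s` is Fubini applied to the layer-cake form of the quantile: the tail integrals of
`erfInv (2 * y - 1)` are explicit because `x * exp (-x²)` is an exact derivative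
(`integral_layer_mul_erfInv`).

For the Kullback–Leibler divergence, the logarithm of a Gaussian density is quadratic, so only the
mean and variance of `q` interact with the parameters. What remains is `log x ≤ x - 1` with its
equality case. -/

/-- The uniform distribution on the unit interval. -/
noncomputable def unif : Measure ℝ := volume.restrict (Ioo 0 1)

instance : IsProbabilityMeasure unif := ⟨by simp [unif]⟩

theorem ae_unif_mem : ∀ᵐ y ∂unif, y ∈ Ioo (0 : ℝ) 1 := ae_restrict_mem measurableSet_Ioo

theorem unif_eq_restrict_Ioc : unif = volume.restrict (Ioc 0 1) :=
  Measure.restrict_congr_set Ioo_ae_eq_Ioc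

theorem intervalIntegral_eq_unif (f : ℝ → ℝ) : ∫ y in (0 : ℝ)..1, f y = ∫ y, f y ∂unif := by
  rw [intervalIntegral.integral_of_le zero_le_one, unif_eq_restrict_Ioc]

theorem intervalIntegrable_iff_unif (f : ℝ → ℝ) :
    IntervalIntegrable f volume 0 1 ↔ Integrable f unif := by
  rw [intervalIntegrable_iff_integrableOn_Ioc_of_le zero_le_one, unif_eq_restrict_Ioc]
  rfl

theorem unif_Ioc {a b : ℝ} (ha : 0 ≤ a) (hb : b ≤ 1) : unif (Ioc a b) = ENNReal.ofReal (b - a) := by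
  rw [unif_eq_restrict_Ioc, Measure.restrict_apply measurableSet_Ioc, Ioc_inter_Ioc,
    max_eq_left ha, min_eq_left hb, Real.volume_Ioc]

theorem unif_Iic {b : ℝ} (hb : b ≤ 1) : unif (Iic b) = ENNReal.ofReal b := by
  rw [unif_eq_restrict_Ioc, Measure.restrict_apply measurableSet_Iic, Iic_inter_Ioc_of_le hb,
    Real.volume_Ioc, sub_zero]

/-! ### Quantile functions as transports of the uniform law. -/

/-- Right continuity of the distribution function makes the infimum a minimum, so quantile and
distribution function form a Galois connection on `(0, 1)`. -/
theorem quantile_le_iff (ν : Measure ℝ) {y : ℝ} (hy : y ∈ Ioo (0 : ℝ) 1) (x : ℝ) :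
    quantile ν y ≤ x ↔ y ≤ cdf ν x := by
  obtain ⟨b, hb⟩ := ((tendsto_cdf_atTop ν).eventually (lt_mem_nhds hy.2)).exists
  obtain ⟨a, ha⟩ := ((tendsto_cdf_atBot ν).eventually (gt_mem_nhds hy.1)).exists
  have hne : {x : ℝ | y ≤ cdf ν x}.Nonempty := ⟨b, hb.le⟩
  have hbdd : BddBelow {x : ℝ | y ≤ cdf ν x} := by
    refine ⟨a, fun x hx => ?_⟩
    by_contra! h
    exact absurd (hx.trans (monotone_cdf ν h.le)) ha.not_ge
  refine ⟨fun h => le_trans ?_ (monotone_cdf ν h), fun h => csInf_le hbdd h⟩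
  have hr : Filter.Tendsto (cdf ν) (nhdsWithin (quantile ν y) (Ioi (quantile ν y)))
      (nhds (cdf ν (quantile ν y))) :=
    ((cdf ν).right_continuous (quantile ν y)).mono_left (nhdsWithin_mono _ Ioi_subset_Ici_self)
  refine ge_of_tendsto hr ?_
  filter_upwards [self_mem_nhdsWithin] with z hz
  obtain ⟨s, hs, hsz⟩ := exists_lt_of_csInf_lt hne hz
  exact le_trans hs (monotone_cdf ν hsz.le)

theorem lt_quantile_iff (ν : Measure ℝ) {y : ℝ} (hy : y ∈ Ioo (0 : ℝ) 1) (x : ℝ) :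
    x < quantile ν y ↔ cdf ν x < y := by
  simpa using (quantile_le_iff ν hy x).not

theorem monotoneOn_quantile (ν : Measure ℝ) : MonotoneOn (quantile ν) (Ioo 0 1) := by
  intro a ha b hb hab
  rw [quantile_le_iff ν ha]
  exact hab.trans ((quantile_le_iff ν hb _).1 le_rfl)

theorem aemeasurable_quantile (ν : Measure ℝ) : AEMeasurable (quantile ν) unif :=
  aemeasurable_restrict_of_monotoneOn measurableSet_Ioo (monotoneOn_quantile ν)

theorem map_quantile (ν : Measure ℝ) [IsProbabilityMeasure ν] : unif.map (quantile ν) = ν := by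
  have : IsProbabilityMeasure (unif.map (quantile ν)) :=
    Measure.isProbabilityMeasure_map (aemeasurable_quantile ν)
  refine Measure.ext_of_Iic _ _ fun x => ?_
  rw [Measure.map_apply_of_aemeasurable (aemeasurable_quantile ν) measurableSet_Iic, ← ofReal_cdf,
    ← unif_Iic (cdf_le_one ν x)]
  refine measure_congr ?_
  filter_upwards [ae_unif_mem] with y hy
  exact propext (quantile_le_iff ν hy x)

/-! ### Optimality of the monotone coupling. -/

/-- The cost of a transport plan as an integral of the masses it moves across intervals. -/
theorem lintegral_sq_sub_eq (π : Measure (ℝ × ℝ)) [SFinite π] :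
    ∫⁻ z : ℝ × ℝ, ENNReal.ofReal ((z.1 - z.2) ^ 2) ∂π =
      ∫⁻ p : ℝ × ℝ, (π {z | z.1 ≤ min p.1 p.2 ∧ max p.1 p.2 < z.2}
        + π {z | z.2 ≤ min p.1 p.2 ∧ max p.1 p.2 < z.1}) := by
  let A : Set ((ℝ × ℝ) × (ℝ × ℝ)) := {w | w.1.1 ≤ min w.2.1 w.2.2 ∧ max w.2.1 w.2.2 < w.1.2}
  let B : Set ((ℝ × ℝ) × (ℝ × ℝ)) := {w | w.1.2 ≤ min w.2.1 w.2.2 ∧ max w.2.1 w.2.2 < w.1.1}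
  have hmin : Measurable fun w : (ℝ × ℝ) × (ℝ × ℝ) => min w.2.1 w.2.2 :=
    Measurable.min (by fun_prop) (by fun_prop)
  have hmax : Measurable fun w : (ℝ × ℝ) × (ℝ × ℝ) => max w.2.1 w.2.2 :=
    Measurable.max (by fun_prop) (by fun_prop)
  have hA : MeasurableSet A :=
    MeasurableSet.inter (s₁ := {w : (ℝ × ℝ) × (ℝ × ℝ) | w.1.1 ≤ min w.2.1 w.2.2})
      (s₂ := {w : (ℝ × ℝ) × (ℝ × ℝ) | max w.2.1 w.2.2 < w.1.2})
      (measurableSet_le (by fun_prop) hmin) (measurableSet_lt hmax (by fun_prop))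
  have hB : MeasurableSet B :=
    MeasurableSet.inter (s₁ := {w : (ℝ × ℝ) × (ℝ × ℝ) | w.1.2 ≤ min w.2.1 w.2.2})
      (s₂ := {w : (ℝ × ℝ) × (ℝ × ℝ) | max w.2.1 w.2.2 < w.1.1})
      (measurableSet_le (by fun_prop) hmin) (measurableSet_lt hmax (by fun_prop))
  -- `(x - z)²` is the area of the square on the interval between `x` and `z`; of the two sections,
  -- one is this square and the other is empty.
  have key : ∀ z : ℝ × ℝ, ENNReal.ofReal ((z.1 - z.2) ^ 2)
      = volume (Prod.mk z ⁻¹' A) + volume (Prod.mk z ⁻¹' B) := by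
    rintro ⟨x, z⟩
    have h1 : Prod.mk (x, z) ⁻¹' A = Ico x z ×ˢ Ico x z := by
      ext p; simp [A]; tauto
    have h2 : Prod.mk (x, z) ⁻¹' B = Ico z x ×ˢ Ico z x := by
      ext p; simp [B]; tauto
    rw [h1, h2, Measure.volume_eq_prod, Measure.prod_prod, Measure.prod_prod, Real.volume_Ico,
      Real.volume_Ico]
    rcases le_total x z with h | h
    · rw [ENNReal.ofReal_of_nonpos (sub_nonpos.2 h), zero_mul, add_zero,
        ← ENNReal.ofReal_mul (sub_nonneg.2 h)]
      congr 1; ring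
    · rw [ENNReal.ofReal_of_nonpos (sub_nonpos.2 h), zero_mul, zero_add,
        ← ENNReal.ofReal_mul (sub_nonneg.2 h)]
      congr 1; ring
  simp_rw [key]
  rw [lintegral_add_left (measurable_measure_prodMk_left hA), ← Measure.prod_apply hA,
    ← Measure.prod_apply hB, Measure.prod_apply_symm hA, Measure.prod_apply_symm hB,
    ← lintegral_add_left (measurable_measure_prodMk_right hA)]
  rfl

theorem measurableSet_fst_le_lt_snd (a b : ℝ) :
    MeasurableSet {z : ℝ × ℝ | z.1 ≤ a ∧ b < z.2} :=
  measurableSet_Iic.prod measurableSet_Ioi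

/-- Mass starting in `(-∞, a]` either ends in `(-∞, b]`, which holds only `cdf ν b`, or crosses into
`(b, ∞)`. -/
theorem ofReal_cdf_sub_le {π : Measure (ℝ × ℝ)} {ξ ν : Measure ℝ} [IsProbabilityMeasure ξ]
    [IsProbabilityMeasure ν] (h₁ : π.map Prod.fst = ξ) (h₂ : π.map Prod.snd = ν) (a b : ℝ) :
    ENNReal.ofReal (cdf ξ a - cdf ν b) ≤ π {z | z.1 ≤ a ∧ b < z.2} := by
  rw [ENNReal.ofReal_sub _ (cdf_nonneg ν b), ofReal_cdf, ofReal_cdf, tsub_le_iff_right,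
    ← h₁, ← h₂, Measure.map_apply measurable_fst measurableSet_Iic,
    Measure.map_apply measurable_snd measurableSet_Iic]
  refine (measure_mono fun z hz => ?_).trans (measure_union_le _ _)
  by_cases hzb : z.2 ≤ b
  · exact Or.inr hzb
  · exact Or.inl ⟨hz, not_le.1 hzb⟩

theorem aemeasurable_quantile_prodMk (ξ ν : Measure ℝ) :
    AEMeasurable (fun y => (quantile ξ y, quantile ν y)) unif :=
  (aemeasurable_quantile ξ).prodMk (aemeasurable_quantile ν)

/-- The levels `y` that cross are exactly those in `(cdf ν b, cdf ξ a]`, so the lower bound for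
arbitrary couplings is attained, including when this interval is empty. -/
theorem map_quantile_prodMk_apply (ξ ν : Measure ℝ) (a b : ℝ) :
    unif.map (fun y => (quantile ξ y, quantile ν y)) {z | z.1 ≤ a ∧ b < z.2}
      = ENNReal.ofReal (cdf ξ a - cdf ν b) := by
  rw [Measure.map_apply_of_aemeasurable (aemeasurable_quantile_prodMk ξ ν)
    (measurableSet_fst_le_lt_snd a b),
    ← unif_Ioc (cdf_nonneg ν b) (cdf_le_one ξ a)]
  refine measure_congr ?_
  filter_upwards [ae_unif_mem] with y hy
  refine propext ?_
  change (quantile ξ y ≤ a ∧ b < quantile ν y) ↔ _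
  rw [quantile_le_iff ξ hy, lt_quantile_iff ν hy, and_comm]
  rfl

theorem map_swap_apply (π : Measure (ℝ × ℝ)) (a b : ℝ) :
    π {z | z.2 ≤ a ∧ b < z.1} = π.map Prod.swap {z | z.1 ≤ a ∧ b < z.2} := by
  rw [Measure.map_apply measurable_swap (measurableSet_fst_le_lt_snd a b)]
  rfl

/-- On the line, the monotone coupling is optimal for the quadratic cost. -/
theorem wassersteinSq_eq_lintegral_quantile (ξ ν : Measure ℝ) [IsProbabilityMeasure ξ]
    [IsProbabilityMeasure ν] :
    wassersteinSq ξ ν = ∫⁻ y, ENNReal.ofReal ((quantile ξ y - quantile ν y) ^ 2) ∂unif := by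
  have hm := aemeasurable_quantile_prodMk ξ ν
  have hcost : ∫⁻ y, ENNReal.ofReal ((quantile ξ y - quantile ν y) ^ 2) ∂unif
      = ∫⁻ z : ℝ × ℝ, ENNReal.ofReal ((z.1 - z.2) ^ 2)
          ∂(unif.map (fun y => (quantile ξ y, quantile ν y))) := by
    rw [lintegral_map' (by fun_prop) hm]
  apply le_antisymm
  · rw [hcost]
    refine iInf₂_le _ ⟨?_, ?_⟩
    · rw [AEMeasurable.map_map_of_aemeasurable (by fun_prop) hm]
      exact map_quantile ξ
    · rw [AEMeasurable.map_map_of_aemeasurable (by fun_prop) hm]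
      exact map_quantile ν
  · refine le_iInf₂ fun π hπ => ?_
    obtain ⟨h₁, h₂⟩ := hπ
    -- A coupling is not assumed finite; its total mass is that of a marginal, which licenses
    -- Tonelli.
    have hfin : IsFiniteMeasure π := by
      refine ⟨?_⟩
      have : π univ = ξ univ := by rw [← h₁, Measure.map_apply measurable_fst .univ, preimage_univ]
      simp [this]
    rw [hcost, lintegral_sq_sub_eq, lintegral_sq_sub_eq]
    refine lintegral_mono fun p => add_le_add ?_ ?_
    · rw [map_quantile_prodMk_apply]
      exact ofReal_cdf_sub_le h₁ h₂ _ _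
    · rw [map_swap_apply, map_swap_apply,
        AEMeasurable.map_map_of_aemeasurable (by fun_prop) hm]
      refine (map_quantile_prodMk_apply ν ξ _ _).le.trans (ofReal_cdf_sub_le ?_ ?_ _ _)
      · rw [Measure.map_map (by fun_prop) (by fun_prop)]
        exact h₂
      · rw [Measure.map_map (by fun_prop) (by fun_prop)]
        exact h₁

/-! ### The error function and Gaussian quantiles. -/

theorem hasDerivAt_erf (x : ℝ) :
    HasDerivAt erf (2 / Real.sqrt Real.pi * Real.exp (-x ^ 2)) x := by
  have hc : Continuous fun t : ℝ => Real.exp (-t ^ 2) := by fun_prop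
  exact (intervalIntegral.integral_hasDerivAt_right (hc.intervalIntegrable _ _)
    (hc.stronglyMeasurableAtFilter _ _) hc.continuousAt).const_mul _

theorem strictMono_erf : StrictMono erf :=
  strictMono_of_deriv_pos fun x => by rw [(hasDerivAt_erf x).deriv]; positivity

theorem continuous_erf : Continuous erf :=
  continuous_iff_continuousAt.2 fun x => (hasDerivAt_erf x).continuousAt

theorem gaussianPDFReal_zero_half (x : ℝ) :
    gaussianPDFReal 0 (1 / 2) x = (Real.sqrt Real.pi)⁻¹ * Real.exp (-x ^ 2) := by
  simp [gaussianPDFReal]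
  field_simp

theorem integrable_exp_neg_sq : Integrable fun x : ℝ => Real.exp (-x ^ 2) := by
  simpa using integrable_exp_neg_mul_sq (b := 1) one_pos

/-- Variance `1 / 2` makes the density `π^(-1/2) * exp (-x²)`, the integrand of `erf` up to scale.
Thus `erfInv (2 * y - 1)` is a genuine quantile function, and its moments are Gaussian moments. -/
theorem cdf_gaussianReal_zero_half (x : ℝ) :
    cdf (gaussianReal 0 (1 / 2)) x = (1 + erf x) / 2 := by
  have hpi : Real.sqrt Real.pi ≠ 0 := by positivity
  have h0 : ∫ t in Iic (0 : ℝ), Real.exp (-t ^ 2) = Real.sqrt Real.pi / 2 := by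
    have h := integral_gaussian_Ioi 1
    have h' := integral_comp_neg_Iic (0 : ℝ) fun t => Real.exp (-t ^ 2)
    simp only [even_two.neg_pow, neg_zero] at h'
    rw [h']
    simpa using h
  have h1 := intervalIntegral.integral_Iic_sub_Iic (a := (0 : ℝ)) (b := x)
    integrable_exp_neg_sq.integrableOn integrable_exp_neg_sq.integrableOn
  rw [cdf_eq_real, measureReal_def, gaussianReal_apply_eq_integral _ (by norm_num),
    ENNReal.toReal_ofReal (integral_nonneg fun _ => gaussianPDFReal_nonneg _ _ _)]
  simp_rw [gaussianPDFReal_zero_half]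
  rw [integral_const_mul, erf, ← h1, h0]
  field_simp
  ring

theorem erf_erfInv {u : ℝ} (hu : u ∈ Ioo (-1 : ℝ) 1) : erf (erfInv u) = u := by
  refine Function.invFun_eq ?_
  have hcdf : ∀ x, erf x = 2 * cdf (gaussianReal 0 (1 / 2)) x - 1 := fun x => by
    rw [cdf_gaussianReal_zero_half]; ring
  obtain ⟨a, ha⟩ := ((tendsto_cdf_atBot (gaussianReal 0 (1 / 2))).eventually
    (gt_mem_nhds (show 0 < (u + 1) / 2 by linarith [hu.1]))).exists
  obtain ⟨b, hb⟩ := ((tendsto_cdf_atTop (gaussianReal 0 (1 / 2))).eventually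
    (lt_mem_nhds (show (u + 1) / 2 < 1 by linarith [hu.2]))).exists
  exact mem_range_of_exists_le_of_exists_ge continuous_erf
    ⟨a, by rw [hcdf]; linarith⟩ ⟨b, by rw [hcdf]; linarith⟩

theorem le_erf_iff {u : ℝ} (hu : u ∈ Ioo (-1 : ℝ) 1) (x : ℝ) : u ≤ erf x ↔ erfInv u ≤ x := by
  rw [← strictMono_erf.le_iff_le (a := erfInv u), erf_erfInv hu]

theorem two_mul_sub_one_mem {y : ℝ} (hy : y ∈ Ioo (0 : ℝ) 1) : 2 * y - 1 ∈ Ioo (-1 : ℝ) 1 :=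
  ⟨by linarith [hy.1], by linarith [hy.2]⟩

theorem gaussianReal_eq_map (m : ℝ) (s : ℝ≥0) :
    gaussianReal m (s ^ 2)
      = (gaussianReal 0 (1 / 2)).map fun x => m + Real.sqrt 2 * s * x := by
  have h : (fun x => m + Real.sqrt 2 * s * x) = (m + ·) ∘ (Real.sqrt 2 * s * ·) := rfl
  rw [h, ← Measure.map_map (by fun_prop) (by fun_prop), gaussianReal_map_const_mul,
    gaussianReal_map_const_add]
  congr 1
  · simp
  · ext
    push_cast
    simp only [mul_pow]
    rw [Real.sq_sqrt zero_le_two]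
    ring

theorem quantile_gaussianReal (m : ℝ) (s : ℝ≥0) {y : ℝ} (hy : y ∈ Ioo (0 : ℝ) 1) :
    quantile (gaussianReal m (s ^ 2)) y = m + Real.sqrt 2 * s * erfInv (2 * y - 1) := by
  refine eq_of_forall_ge_iff fun x => ?_
  rw [quantile_le_iff _ hy]
  rcases eq_or_ne s 0 with rfl | hs
  · rw [zero_pow two_ne_zero, gaussianReal_zero_var, cdf_eq_real]
    by_cases hx : m ≤ x
    · simp [measureReal_def, hx, hy.2.le]
    · simp [measureReal_def, hx, hy.1]
  · have hc : 0 < Real.sqrt 2 * s := by positivity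
    have hset : (fun x => m + Real.sqrt 2 * s * x) ⁻¹' Iic x
        = Iic ((x - m) / (Real.sqrt 2 * s)) := by
      ext z
      simp only [mem_preimage, mem_Iic, le_div_iff₀ hc]
      constructor <;> intro h <;> linarith
    rw [cdf_eq_real, gaussianReal_eq_map, measureReal_def,
      Measure.map_apply (by fun_prop) measurableSet_Iic, hset, ← measureReal_def, ← cdf_eq_real,
      cdf_gaussianReal_zero_half, ← le_sub_iff_add_le', ← le_div_iff₀' hc,
      ← le_erf_iff (two_mul_sub_one_mem hy)]
    constructor <;> intro h <;> linarith

theorem quantile_gaussianReal_zero_half {y : ℝ} (hy : y ∈ Ioo (0 : ℝ) 1) :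
    quantile (gaussianReal 0 (1 / 2)) y = erfInv (2 * y - 1) := by
  refine eq_of_forall_ge_iff fun x => ?_
  rw [quantile_le_iff _ hy, cdf_gaussianReal_zero_half, ← le_erf_iff (two_mul_sub_one_mem hy)]
  constructor <;> intro h <;> linarith

theorem quantile_ae_eq_erfInv :
    quantile (gaussianReal 0 (1 / 2)) =ᵐ[unif] fun y => erfInv (2 * y - 1) := by
  filter_upwards [ae_unif_mem] with y hy using quantile_gaussianReal_zero_half hy

theorem aemeasurable_erfInv : AEMeasurable (fun y => erfInv (2 * y - 1)) unif :=
  (aemeasurable_quantile _).congr quantile_ae_eq_erfInv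

theorem map_erfInv : unif.map (fun y => erfInv (2 * y - 1)) = gaussianReal 0 (1 / 2) := by
  rw [← Measure.map_congr quantile_ae_eq_erfInv, map_quantile]

theorem memLp_quantile {q : Measure ℝ} [IsProbabilityMeasure q] (hq : MemLp id 2 q) :
    MemLp (quantile q) 2 unif := by
  rw [← map_quantile q] at hq
  exact (memLp_map_measure_iff (by fun_prop) (aemeasurable_quantile q)).1 hq

theorem integral_quantile (q : Measure ℝ) [IsProbabilityMeasure q] :
    ∫ y, quantile q y ∂unif = ∫ x, x ∂q := by
  conv_rhs => rw [← map_quantile q]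
  exact (integral_map (f := fun x => x) (aemeasurable_quantile q) (by fun_prop)).symm

theorem memLp_erfInv : MemLp (fun y => erfInv (2 * y - 1)) 2 unif :=
  (memLp_congr_ae quantile_ae_eq_erfInv).1
    (memLp_quantile (memLp_id_gaussianReal' 2 ENNReal.ofNat_ne_top))

theorem integral_erfInv : ∫ y, erfInv (2 * y - 1) ∂unif = 0 := by
  rw [← integral_congr_ae quantile_ae_eq_erfInv, integral_quantile, integral_id_gaussianReal]

theorem integral_erfInv_sq : ∫ y, erfInv (2 * y - 1) ^ 2 ∂unif = 1 / 2 := by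
  have h := variance_id_gaussianReal (μ := 0) (v := 1 / 2)
  rw [variance_of_integral_eq_zero aemeasurable_id (by simp),
    ← map_erfInv, integral_map aemeasurable_erfInv (by fun_prop)] at h
  simpa using h

/-! ### The two formulas for the optimal standard deviation. -/

theorem expNegErfInvSq_of_mem {u : ℝ} (hu : u ∈ Ioo (-1 : ℝ) 1) :
    expNegErfInvSq u = Real.exp (-erfInv u ^ 2) := by
  rw [expNegErfInvSq, erfInvExt, if_neg hu.1.not_ge, if_neg hu.2.not_ge, ← EReal.coe_pow,
    ← EReal.coe_neg, EReal.exp_coe, ENNReal.toReal_ofReal (Real.exp_pos _).le]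

theorem expNegErfInvSq_neg_one : expNegErfInvSq (-1) = 0 := by
  simp [expNegErfInvSq, erfInvExt, sq]

theorem expNegErfInvSq_one : expNegErfInvSq 1 = 0 := by
  have h : ¬ (1 : ℝ) ≤ -1 := by norm_num
  simp [expNegErfInvSq, erfInvExt, sq, h]

theorem expNegErfInvSq_nonneg (u : ℝ) : 0 ≤ expNegErfInvSq u := ENNReal.toReal_nonneg

theorem integral_Ioi_id_gaussianReal (g : ℝ) :
    ∫ x in Ioi g, x ∂(gaussianReal 0 (1 / 2)) = 1 / (2 * Real.sqrt Real.pi) * Real.exp (-g ^ 2) := by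
  have hv : (1 / 2 : ℝ≥0) ≠ 0 := by norm_num
  have hint : Integrable fun x : ℝ => x * Real.exp (-x ^ 2) := by
    simpa using integrable_mul_exp_neg_mul_sq (b := 1) one_pos
  have hd : ∀ x ∈ Ici g, HasDerivAt (fun x : ℝ => -(1 / 2) * Real.exp (-x ^ 2))
      (x * Real.exp (-x ^ 2)) x := fun x _ => by
    have h := (((hasDerivAt_pow 2 x).neg).exp).const_mul (-(1 / 2) : ℝ)
    refine h.congr_deriv ?_
    simp only [Pi.neg_apply, Nat.cast_ofNat, Nat.reduceSub, pow_one]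
    ring
  have ht : Filter.Tendsto (fun x : ℝ => -(1 / 2) * Real.exp (-x ^ 2)) Filter.atTop
      (nhds (-(1 / 2) * 0)) := by
    refine Filter.Tendsto.const_mul _ (Real.tendsto_exp_neg_atTop_nhds_zero.comp ?_)
    exact Filter.tendsto_pow_atTop two_ne_zero
  have hI := integral_Ioi_of_hasDerivAt_of_tendsto' hd hint.integrableOn ht
  rw [← integral_indicator measurableSet_Ioi, integral_gaussianReal_eq_integral_smul hv]
  have heq : (fun x => gaussianPDFReal 0 (1 / 2) x • (Ioi g).indicator (fun x => x) x)
      = (Ioi g).indicator fun x => (Real.sqrt Real.pi)⁻¹ * (x * Real.exp (-x ^ 2)) := by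
    ext x
    rw [gaussianPDFReal_zero_half]
    by_cases hx : x ∈ Ioi g
    · simp only [indicator_of_mem hx, smul_eq_mul]; ring
    · simp only [indicator_of_notMem hx, smul_zero]
  rw [heq, integral_indicator measurableSet_Ioi, integral_const_mul, hI]
  field_simp
  ring

/-- Substituting `x = erfInv (2 * y - 1)` gives a tail first moment of the Gaussian of variance `1 /
2`. -/
theorem setIntegral_Ioi_erfInv {t : ℝ} (ht : t ∈ Icc (0 : ℝ) 1) :
    ∫ y in Ioi t, erfInv (2 * y - 1) ∂unif
      = 1 / (2 * Real.sqrt Real.pi) * expNegErfInvSq (2 * t - 1) := by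
  -- At `t = 0` the integral is the vanishing mean, at `t = 1` the domain is null; both agree with
  -- the convention `exp (-∞) = 0`.
  rcases eq_or_lt_of_le ht.1 with rfl | h0
  · have h : (Ioi 0 : Set ℝ) =ᵐ[unif] univ := by
      filter_upwards [ae_unif_mem] with y hy using propext (iff_of_true hy.1 trivial)
    rw [setIntegral_congr_set h, setIntegral_univ, integral_erfInv, mul_zero, zero_sub,
      expNegErfInvSq_neg_one, mul_zero]
  rcases eq_or_lt_of_le ht.2 with rfl | h1
  · have h : (Ioi 1 : Set ℝ) =ᵐ[unif] (∅ : Set ℝ) := by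
      filter_upwards [ae_unif_mem] with y hy
        using propext (iff_of_false (not_lt.2 hy.2.le) (notMem_empty y))
    rw [setIntegral_congr_set h, setIntegral_empty, show (2 * 1 - 1 : ℝ) = 1 by norm_num,
      expNegErfInvSq_one, mul_zero]
  · have hu := two_mul_sub_one_mem ⟨h0, h1⟩
    have h : (Ioi t : Set ℝ) =ᵐ[unif]
        (fun y => erfInv (2 * y - 1)) ⁻¹' Ioi (erfInv (2 * t - 1)) := by
      filter_upwards [ae_unif_mem] with y hy
      refine propext ?_
      change t < y ↔ erfInv (2 * t - 1) < erfInv (2 * y - 1)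
      rw [← strictMono_erf.lt_iff_lt (a := erfInv _), erf_erfInv hu, erf_erfInv (two_mul_sub_one_mem hy)]
      constructor <;> intro h <;> linarith
    rw [setIntegral_congr_set h, expNegErfInvSq_of_mem hu, ← integral_Ioi_id_gaussianReal,
      ← map_erfInv]
    exact (setIntegral_map (f := fun x => x) measurableSet_Ioi (by fun_prop)
      aemeasurable_erfInv).symm

theorem integrable_quantile_mul_erfInv {q : Measure ℝ} [IsProbabilityMeasure q]
    (hq : MemLp id 2 q) : Integrable (fun y => quantile q y * erfInv (2 * y - 1)) unif :=
  (memLp_quantile hq).integrable_mul memLp_erfInv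

/-- The signed indicator of the region between `0` and the quantile at level `y`. -/
noncomputable def layer (q : Measure ℝ) (y f : ℝ) : ℝ :=
  if 0 ≤ f then (if cdf q f < y then 1 else 0) else (if cdf q f < y then 0 else -1)

theorem measurable_layer (q : Measure ℝ) : Measurable fun p : ℝ × ℝ => layer q p.1 p.2 := by
  have hF : Measurable (cdf q) := (monotone_cdf q).measurable
  have hlt : MeasurableSet {p : ℝ × ℝ | cdf q p.2 < p.1} :=
    measurableSet_lt (by fun_prop) (by fun_prop)
  exact Measurable.ite (measurableSet_le (by fun_prop) (by fun_prop))
    (Measurable.ite hlt measurable_const measurable_const)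
    (Measurable.ite hlt measurable_const measurable_const)

theorem layer_eq (q : Measure ℝ) {y : ℝ} (hy : y ∈ Ioo (0 : ℝ) 1) :
    layer q y = (Ico 0 (quantile q y)).indicator 1 - (Ico (quantile q y) 0).indicator 1 := by
  ext f
  simp only [layer, ← lt_quantile_iff q hy, Pi.sub_apply, indicator, mem_Ico, Pi.one_apply]
  grind

theorem integrable_indicator_Ico_one (a b : ℝ) :
    Integrable ((Ico a b).indicator (1 : ℝ → ℝ)) :=
  (integrable_indicator_iff measurableSet_Ico).2 (integrableOn_const (by simp))

theorem integrable_layer (q : Measure ℝ) {y : ℝ} (hy : y ∈ Ioo (0 : ℝ) 1) :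
    Integrable (layer q y) := by
  rw [layer_eq q hy]
  exact (integrable_indicator_Ico_one _ _).sub (integrable_indicator_Ico_one _ _)

theorem integral_layer (q : Measure ℝ) {y : ℝ} (hy : y ∈ Ioo (0 : ℝ) 1) :
    ∫ f, layer q y f = quantile q y := by
  rw [layer_eq q hy, integral_sub' (integrable_indicator_Ico_one _ _)
    (integrable_indicator_Ico_one _ _),
    integral_indicator_one measurableSet_Ico, integral_indicator_one measurableSet_Ico]
  simp only [measureReal_def, Real.volume_Ico, sub_zero, zero_sub]
  rcases le_total 0 (quantile q y) with h | h
  · rw [ENNReal.toReal_ofReal h, ENNReal.ofReal_of_nonpos (by linarith)]; simp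
  · rw [ENNReal.ofReal_of_nonpos h, ENNReal.toReal_ofReal (neg_nonneg.2 h)]; simp

/-- For fixed `y` the layer has constant sign, one of the two intervals being empty. This gives the
absolute integrability needed for Fubini. -/
theorem integral_norm_layer (q : Measure ℝ) {y : ℝ} (hy : y ∈ Ioo (0 : ℝ) 1) :
    ∫ f, ‖layer q y f‖ = |quantile q y| := by
  rcases le_total 0 (quantile q y) with h | h
  · have hn : ∀ f, ‖layer q y f‖ = layer q y f := fun f => by
      rw [layer_eq q hy, Ico_eq_empty h.not_gt, indicator_empty, Pi.sub_apply, sub_zero]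
      exact Real.norm_of_nonneg (indicator_nonneg (fun _ _ => zero_le_one) _)
    simp_rw [hn]
    rw [integral_layer q hy, abs_of_nonneg h]
  · have hn : ∀ f, ‖layer q y f‖ = -layer q y f := fun f => by
      rw [layer_eq q hy, Ico_eq_empty h.not_gt, indicator_empty, Pi.sub_apply, zero_sub, norm_neg,
        neg_neg]
      exact Real.norm_of_nonneg (indicator_nonneg (fun _ _ => zero_le_one) _)
    simp_rw [hn]
    rw [integral_neg, integral_layer q hy, abs_of_nonpos h]

theorem integrable_layer_mul_erfInv {q : Measure ℝ} [IsProbabilityMeasure q]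
    (hq : MemLp id 2 q) :
    Integrable (fun p : ℝ × ℝ => layer q p.1 p.2 * erfInv (2 * p.1 - 1)) (unif.prod volume) := by
  rw [integrable_prod_iff]
  · constructor
    · filter_upwards [ae_unif_mem] with y hy using (integrable_layer q hy).mul_const _
    · refine (integrable_quantile_mul_erfInv hq).norm.congr ?_
      filter_upwards [ae_unif_mem] with y hy
      simp only [norm_mul]
      rw [integral_mul_const, integral_norm_layer q hy, Real.norm_eq_abs (quantile q y)]
  · exact (measurable_layer q).aestronglyMeasurable.mul
      (aemeasurable_erfInv.aestronglyMeasurable.comp_fst)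

/-- For `f ≥ 0` this is the tail integral over `y > cdf q f`. For `f < 0` it is minus the integral
over the complement, which is the same number since `erfInv (2 * y - 1)` has mean zero. -/
theorem integral_layer_mul_erfInv (q : Measure ℝ) (f : ℝ) :
    ∫ y, layer q y f * erfInv (2 * y - 1) ∂unif
      = 1 / (2 * Real.sqrt Real.pi) * expNegErfInvSq (2 * cdf q f - 1) := by
  rw [← setIntegral_Ioi_erfInv ⟨cdf_nonneg q f, cdf_le_one q f⟩]
  have hint : Integrable (fun y => erfInv (2 * y - 1)) unif :=
    memLp_erfInv.integrable one_le_two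
  rcases le_or_gt 0 f with h | h
  · rw [← integral_indicator measurableSet_Ioi]
    refine integral_congr_ae (.of_forall fun y => ?_)
    by_cases hy : cdf q f < y <;> simp [layer, h, hy]
  · have h0 := integral_add_compl (measurableSet_Ioi (a := cdf q f)) hint
    rw [integral_erfInv, ← eq_neg_iff_add_eq_zero] at h0
    rw [h0, ← integral_indicator measurableSet_Ioi.compl, ← integral_neg]
    refine integral_congr_ae (.of_forall fun y => ?_)
    by_cases hy : cdf q f < y <;> simp [layer, h.not_ge, indicator, hy]

theorem integrable_expNegErfInvSq {q : Measure ℝ} [IsProbabilityMeasure q]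
    (hq : MemLp id 2 q) : Integrable fun f => expNegErfInvSq (2 * cdf q f - 1) := by
  have h := (integrable_layer_mul_erfInv hq).integral_prod_right
  simp only [integral_layer_mul_erfInv] at h
  exact (integrable_const_mul_iff (IsUnit.mk0 _ (by positivity)) _).1 h

theorem integral_quantile_mul_erfInv {q : Measure ℝ} [IsProbabilityMeasure q]
    (hq : MemLp id 2 q) :
    ∫ y, quantile q y * erfInv (2 * y - 1) ∂unif
      = 1 / (2 * Real.sqrt Real.pi) * ∫ f, expNegErfInvSq (2 * cdf q f - 1) := by
  have h := integral_integral_swap (f := fun y f => layer q y f * erfInv (2 * y - 1))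
    (integrable_layer_mul_erfInv hq)
  simp only [integral_layer_mul_erfInv, integral_mul_const, integral_const_mul] at h
  rw [← h]
  refine integral_congr_ae ?_
  filter_upwards [ae_unif_mem] with y hy
  rw [integral_layer q hy]

/-- A distribution function with values only `0` and `1` is a single step, located at the median. -/
theorem exists_cdf_mem_Ioo {q : Measure ℝ} [IsProbabilityMeasure q]
    (hq : ∀ a, q ≠ Measure.dirac a) : ∃ x, cdf q x ∈ Ioo (0 : ℝ) 1 := by
  by_contra! h
  have hy : (1 / 2 : ℝ) ∈ Ioo (0 : ℝ) 1 := by norm_num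
  refine hq (quantile q (1 / 2)) (Measure.ext_of_Iic _ _ fun x => ?_)
  rw [← ofReal_cdf, Measure.dirac_apply' _ measurableSet_Iic]
  have hx := h x
  rw [mem_Ioo, not_and, not_lt] at hx
  by_cases hqx : quantile q (1 / 2) ≤ x
  · have h1 := (quantile_le_iff q hy x).1 hqx
    rw [le_antisymm (cdf_le_one q x) (hx (by linarith))]
    rw [indicator_of_mem (mem_Iic.2 hqx), Pi.one_apply, ENNReal.ofReal_one]
  · have h1 := (lt_quantile_iff q hy x).1 (not_le.1 hqx)
    have h2 : cdf q x = 0 := by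
      refine le_antisymm (not_lt.1 fun h0 => ?_) (cdf_nonneg q x)
      linarith [hx h0]
    rw [h2, indicator_of_notMem (by simpa using hqx), ENNReal.ofReal_zero]

theorem integral_expNegErfInvSq_pos {q : Measure ℝ} [IsProbabilityMeasure q]
    (hq : MemLp id 2 q) (hd : ∀ a, q ≠ Measure.dirac a) :
    0 < ∫ f, expNegErfInvSq (2 * cdf q f - 1) := by
  rw [integral_pos_iff_support_of_nonneg (fun _ => expNegErfInvSq_nonneg _)
    (integrable_expNegErfInvSq hq)]
  obtain ⟨x, hx⟩ := exists_cdf_mem_Ioo hd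
  -- Right continuity keeps the distribution function below `1` on some `[x, z)`, a set of positive
  -- length where the integrand is positive.
  have hr := (cdf q).right_continuous x
  obtain ⟨z, hxz, hz⟩ := mem_nhdsGE_iff_exists_Ico_subset.1 (hr (Iio_mem_nhds hx.2))
  refine lt_of_lt_of_le ?_ (measure_mono (s := Ico x z) fun f hf => ?_)
  · simpa using hxz
  · have hf1 : cdf q f < 1 := hz hf
    rw [Function.mem_support,
      expNegErfInvSq_of_mem (two_mul_sub_one_mem ⟨hx.1.trans_le (monotone_cdf q hf.1), hf1⟩)]
    positivity

/-! ### Minimising the Wasserstein distance. -/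

theorem integrable_sq_quantile_sub {q ν : Measure ℝ} [IsProbabilityMeasure q]
    [IsProbabilityMeasure ν] (hq : MemLp id 2 q) (hν : MemLp id 2 ν) :
    Integrable (fun y => (quantile q y - quantile ν y) ^ 2) unif :=
  ((memLp_quantile hq).sub (memLp_quantile hν)).integrable_sq

theorem wassersteinSq_eq_ofReal {q ν : Measure ℝ} [IsProbabilityMeasure q]
    [IsProbabilityMeasure ν] (hq : MemLp id 2 q) (hν : MemLp id 2 ν) :
    wassersteinSq q ν = ENNReal.ofReal (∫ y, (quantile q y - quantile ν y) ^ 2 ∂unif) := by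
  rw [wassersteinSq_eq_lintegral_quantile, ofReal_integral_eq_lintegral_ofReal
    (integrable_sq_quantile_sub hq hν) (.of_forall fun _ => sq_nonneg _)]

/-- The candidate for the standard deviation of the closest Gaussian. -/
noncomputable def quantileSigma (q : Measure ℝ) : ℝ :=
  Real.sqrt 2 * ∫ y, quantile q y * erfInv (2 * y - 1) ∂unif

theorem quantileSigma_eq {q : Measure ℝ} [IsProbabilityMeasure q] (hq : MemLp id 2 q) :
    quantileSigma q
      = 1 / Real.sqrt (2 * Real.pi) * ∫ f, expNegErfInvSq (2 * cdf q f - 1) := by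
  rw [quantileSigma, integral_quantile_mul_erfInv hq, ← mul_assoc, Real.sqrt_mul zero_le_two]
  congr 1
  have h2 : Real.sqrt 2 * Real.sqrt 2 = 2 := Real.mul_self_sqrt zero_le_two
  field_simp
  linarith

theorem quantileSigma_nonneg {q : Measure ℝ} [IsProbabilityMeasure q] (hq : MemLp id 2 q) :
    0 ≤ quantileSigma q := by
  rw [quantileSigma_eq hq]
  exact mul_nonneg (by positivity) (integral_nonneg fun _ => expNegErfInvSq_nonneg _)

theorem quantileSigma_pos {q : Measure ℝ} [IsProbabilityMeasure q] (hq : MemLp id 2 q)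
    (hd : ∀ a, q ≠ Measure.dirac a) : 0 < quantileSigma q := by
  rw [quantileSigma_eq hq]
  exact mul_pos (by positivity) (integral_expNegErfInvSq_pos hq hd)

theorem integral_sq_quantile_sub_gaussianReal {q : Measure ℝ} [IsProbabilityMeasure q]
    (hq : MemLp id 2 q) (m : ℝ) (s : ℝ≥0) :
    ∫ y, (quantile q y - quantile (gaussianReal m (s ^ 2)) y) ^ 2 ∂unif
      = (∫ y, quantile q y ^ 2 ∂unif - (∫ x, x ∂q) ^ 2 - quantileSigma q ^ 2)
        + ((m - ∫ x, x ∂q) ^ 2 + (s - quantileSigma q) ^ 2) := by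
  have hQ := memLp_quantile hq
  have hE := memLp_erfInv
  have i1 := hQ.integrable_sq
  have i2 : Integrable (quantile q) unif := hQ.integrable one_le_two
  have i3 := integrable_quantile_mul_erfInv hq
  have i4 : Integrable (fun y => erfInv (2 * y - 1)) unif := hE.integrable one_le_two
  have i5 := hE.integrable_sq
  have h2 : Real.sqrt 2 ^ 2 = 2 := Real.sq_sqrt zero_le_two
  have hexp : (fun y => (quantile q y - quantile (gaussianReal m (s ^ 2)) y) ^ 2) =ᵐ[unif]
      fun y => quantile q y ^ 2 + ((-2 * m) * quantile q y
        + ((-2 * Real.sqrt 2 * s) * (quantile q y * erfInv (2 * y - 1))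
        + ((2 * m * Real.sqrt 2 * s) * erfInv (2 * y - 1)
        + ((2 * s ^ 2) * erfInv (2 * y - 1) ^ 2 + m ^ 2)))) := by
    filter_upwards [ae_unif_mem] with y hy
    rw [quantile_gaussianReal m s hy]
    linear_combination (s * erfInv (2 * y - 1)) ^ 2 * h2
  have j5 := (i5.const_mul (2 * (s : ℝ) ^ 2)).fun_add (integrable_const (m ^ 2))
  have j4 := (i4.const_mul (2 * m * Real.sqrt 2 * s)).fun_add j5
  have j3 := (i3.const_mul (-2 * Real.sqrt 2 * s)).fun_add j4
  have j2 := (i2.const_mul (-2 * m)).fun_add j3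
  rw [integral_congr_ae hexp, integral_add i1 j2, integral_add (i2.const_mul _) j3,
    integral_add (i3.const_mul _) j4, integral_add (i4.const_mul _) j5,
    integral_add (i5.const_mul _) (integrable_const _)]
  simp only [integral_const_mul, integral_const, integral_erfInv, integral_erfInv_sq,
    integral_quantile, quantileSigma, probReal_univ, smul_eq_mul]
  ring

theorem wassersteinSq_gaussianReal {q : Measure ℝ} [IsProbabilityMeasure q]
    (hq : MemLp id 2 q) (m : ℝ) (s : ℝ≥0) :
    wassersteinSq q (gaussianReal m (s ^ 2)) = ENNReal.ofReal
      ((∫ y, quantile q y ^ 2 ∂unif - (∫ x, x ∂q) ^ 2 - quantileSigma q ^ 2)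
        + ((m - ∫ x, x ∂q) ^ 2 + (s - quantileSigma q) ^ 2)) := by
  rw [wassersteinSq_eq_ofReal hq (memLp_id_gaussianReal' 2 ENNReal.ofNat_ne_top),
    integral_sq_quantile_sub_gaussianReal hq]

/-- A general `S` containing the candidate serves both the minimisation over `σ ≥ 0` and the one
over `σ > 0`. -/
theorem isMinOn_wassersteinSq_iff {q : Measure ℝ} [IsProbabilityMeasure q] (hq : MemLp id 2 q)
    {S : Set (ℝ × ℝ≥0)} (hS : (∫ x, x ∂q, (quantileSigma q).toNNReal) ∈ S) (m : ℝ) (s : ℝ≥0) :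
    IsMinOn (fun p : ℝ × ℝ≥0 => wassersteinSq q (gaussianReal p.1 (p.2 ^ 2))) S (m, s) ↔
      m = ∫ x, x ∂q ∧ (s : ℝ) = quantileSigma q := by
  have hσ := Real.coe_toNNReal _ (quantileSigma_nonneg hq)
  -- The constant is the squared distance at the candidate. Its sign matters because
  -- `ENNReal.ofReal` truncates, so comparing values needs nonnegativity.
  have hC : 0 ≤ ∫ y, quantile q y ^ 2 ∂unif - (∫ x, x ∂q) ^ 2 - quantileSigma q ^ 2 := by
    have h := integral_sq_quantile_sub_gaussianReal hq (∫ x, x ∂q) (quantileSigma q).toNNReal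
    rw [hσ] at h
    simp only [sub_self, zero_pow two_ne_zero, add_zero] at h
    rw [← h]
    exact integral_nonneg fun _ => sq_nonneg _
  simp only [isMinOn_iff, wassersteinSq_gaussianReal hq]
  constructor
  · intro h
    have h1 := h _ hS
    rw [hσ, ENNReal.ofReal_le_ofReal_iff (by positivity)] at h1
    have h3 : (m - ∫ x, x ∂q) ^ 2 = 0 := by
      nlinarith [sq_nonneg (m - ∫ x, x ∂q), sq_nonneg (s - quantileSigma q)]
    have h4 : ((s : ℝ) - quantileSigma q) ^ 2 = 0 := by
      nlinarith [sq_nonneg (m - ∫ x, x ∂q), sq_nonneg (s - quantileSigma q)]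
    exact ⟨sub_eq_zero.1 (pow_eq_zero_iff two_ne_zero |>.1 h3),
      sub_eq_zero.1 (pow_eq_zero_iff two_ne_zero |>.1 h4)⟩
  · rintro ⟨h1, h2⟩ p -
    refine ENNReal.ofReal_le_ofReal ?_
    rw [h1, h2]
    simp only [sub_self, zero_pow two_ne_zero, add_zero]
    exact le_add_of_nonneg_right (by positivity)

/-! ### The Kullback–Leibler divergence -/

/-- Chain rule for densities: `dq/dN` is `dq/dx` divided by the Gaussian density. It is stated
`q`-almost everywhere, where `dq/dx` is positive and finite and the logarithm splits. -/
theorem llr_gaussianReal {q : Measure ℝ} [IsProbabilityMeasure q] (hq : q ≪ volume) (m : ℝ)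
    {v : ℝ≥0} (hv : v ≠ 0) :
    llr q (gaussianReal m v) =ᵐ[q]
      fun x => llr q volume x - Real.log (gaussianPDFReal m v x) := by
  have h := Measure.rnDeriv_withDensity_right q volume
    (measurable_gaussianPDF m v).aemeasurable (.of_forall fun x => (gaussianPDF_pos m hv x).ne')
    (.of_forall fun x => gaussianPDF_ne_top)
  filter_upwards [hq.ae_le h, Measure.rnDeriv_pos hq, hq.ae_le (Measure.rnDeriv_lt_top q volume)]
    with x hx h0 htop
  have hp := gaussianPDFReal_pos m v x hv
  rw [gaussianReal_of_var_ne_zero m hv, llr, hx, ENNReal.toReal_mul, ENNReal.toReal_inv,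
    toReal_gaussianPDF, Real.log_mul (by positivity) (ENNReal.toReal_pos h0.ne' htop.ne).ne',
    Real.log_inv, llr]
  ring

theorem log_gaussianPDFReal (m : ℝ) {s : ℝ≥0} (hs : 0 < s) (x : ℝ) :
    Real.log (gaussianPDFReal m (s ^ 2) x)
      = -(Real.log (2 * Real.pi) + Real.log ((s : ℝ) ^ 2)) / 2
        - (x - m) ^ 2 / (2 * (s : ℝ) ^ 2) := by
  have hs' : (0 : ℝ) < s := hs
  rw [gaussianPDFReal, Real.log_mul (by positivity) (by positivity), Real.log_exp, Real.log_inv,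
    Real.log_sqrt (by positivity), NNReal.coe_pow, Real.log_mul (by positivity) (by positivity)]
  ring

theorem integrable_sq_sub_const {q : Measure ℝ} [IsProbabilityMeasure q] (hq : MemLp id 2 q)
    (m : ℝ) : Integrable (fun x => (x - m) ^ 2) q :=
  (hq.sub (memLp_const m)).integrable_sq

theorem integral_sq_sub_const {q : Measure ℝ} [IsProbabilityMeasure q] (hq : MemLp id 2 q)
    (m : ℝ) : ∫ x, (x - m) ^ 2 ∂q = variance id q + (m - ∫ x, x ∂q) ^ 2 := by
  have i1 : Integrable (fun x : ℝ => x) q := hq.integrable one_le_two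
  have i2 : Integrable (fun x : ℝ => x ^ 2) q := hq.integrable_sq
  have hv := variance_eq_sub hq
  simp only [Pi.pow_apply, id_eq] at hv
  have hexp : ∀ x : ℝ, (x - m) ^ 2 = x ^ 2 + ((-2 * m) * x + m ^ 2) := fun x => by ring
  simp_rw [hexp]
  rw [integral_add i2 ((i1.const_mul _).fun_add (integrable_const _)),
    integral_add (i1.const_mul _) (integrable_const _), integral_const_mul, hv]
  simp only [integral_const, probReal_univ, smul_eq_mul]
  ring

theorem integrable_log_gaussianPDFReal {q : Measure ℝ} [IsProbabilityMeasure q]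
    (hq : MemLp id 2 q) (m : ℝ) {s : ℝ≥0} (hs : 0 < s) :
    Integrable (fun x => Real.log (gaussianPDFReal m (s ^ 2) x)) q := by
  simp_rw [log_gaussianPDFReal m hs]
  exact (integrable_const _).sub ((integrable_sq_sub_const hq m).div_const _)

theorem integral_log_gaussianPDFReal {q : Measure ℝ} [IsProbabilityMeasure q]
    (hq : MemLp id 2 q) (m : ℝ) {s : ℝ≥0} (hs : 0 < s) :
    ∫ x, Real.log (gaussianPDFReal m (s ^ 2) x) ∂q
      = -(Real.log (2 * Real.pi) + Real.log ((s : ℝ) ^ 2)) / 2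
        - (variance id q + (m - ∫ x, x ∂q) ^ 2) / (2 * (s : ℝ) ^ 2) := by
  simp_rw [log_gaussianPDFReal m hs]
  rw [integral_sub (integrable_const _) ((integrable_sq_sub_const hq m).div_const _),
    integral_div _ fun x => (x - m) ^ 2, integral_sq_sub_const hq]
  simp

theorem absolutelyContinuous_of_klDiv_gaussianReal {q : Measure ℝ} {m : ℝ} {s : ℝ≥0}
    (hs : 0 < s) (h : InformationTheory.klDiv q (gaussianReal m (s ^ 2)) ≠ ⊤) : q ≪ volume :=
  (InformationTheory.klDiv_ne_top_iff.1 h).1.trans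
    (gaussianReal_absolutelyContinuous m (pow_ne_zero 2 hs.ne'))

/-- The Gaussian log-density is quadratic, hence `q`-integrable. Finiteness against one Gaussian
therefore gives `q` a finite entropy, and with it finiteness against all nondegenerate Gaussians. -/
theorem integrable_llr_of_klDiv_gaussianReal {q : Measure ℝ} [IsProbabilityMeasure q]
    (hq : MemLp id 2 q) {m : ℝ} {s : ℝ≥0} (hs : 0 < s)
    (h : InformationTheory.klDiv q (gaussianReal m (s ^ 2)) ≠ ⊤) :
    Integrable (llr q volume) q := by
  have h1 := (InformationTheory.klDiv_ne_top_iff.1 h).2.congr (llr_gaussianReal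
    (absolutelyContinuous_of_klDiv_gaussianReal hs h) m (pow_ne_zero 2 hs.ne'))
  refine (h1.add (integrable_log_gaussianPDFReal hq m hs)).congr (.of_forall fun x => ?_)
  simp

theorem klDiv_gaussianReal_ne_top {q : Measure ℝ} [IsProbabilityMeasure q] (hq : MemLp id 2 q)
    (hac : q ≪ volume) (hllr : Integrable (llr q volume) q) (m : ℝ) {s : ℝ≥0} (hs : 0 < s) :
    InformationTheory.klDiv q (gaussianReal m (s ^ 2)) ≠ ⊤ := by
  have hv : s ^ 2 ≠ 0 := pow_ne_zero 2 hs.ne'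
  exact InformationTheory.klDiv_ne_top (hac.trans (gaussianReal_absolutelyContinuous' m hv))
    ((hllr.sub (integrable_log_gaussianPDFReal hq m hs)).congr (llr_gaussianReal hac m hv).symm)

theorem toReal_klDiv_gaussianReal {q : Measure ℝ} [IsProbabilityMeasure q] (hq : MemLp id 2 q)
    (hac : q ≪ volume) (hllr : Integrable (llr q volume) q) (m : ℝ) {s : ℝ≥0} (hs : 0 < s) :
    (InformationTheory.klDiv q (gaussianReal m (s ^ 2))).toReal
      = (∫ x, llr q volume x ∂q + Real.log (2 * Real.pi) / 2)
        + (Real.log ((s : ℝ) ^ 2)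
          + (variance id q + (m - ∫ x, x ∂q) ^ 2) / (s : ℝ) ^ 2) / 2 := by
  have hv : s ^ 2 ≠ 0 := pow_ne_zero 2 hs.ne'
  rw [InformationTheory.toReal_klDiv_of_measure_eq
      (hac.trans (gaussianReal_absolutelyContinuous' m hv)) (by simp),
    integral_congr_ae (llr_gaussianReal hac m hv),
    integral_sub hllr (integrable_log_gaussianPDFReal hq m hs),
    integral_log_gaussianPDFReal hq m hs]
  ring

/-- Zero variance would concentrate `q` on its mean, a Lebesgue null set. -/
theorem variance_id_pos {q : Measure ℝ} [IsProbabilityMeasure q] (hq : MemLp id 2 q)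
    (hac : q ≪ volume) : 0 < variance id q := by
  refine (variance_nonneg _ _).lt_of_ne' fun h => ?_
  have h1 := ae_eq_integral_of_variance_eq_zero hq h
  have h2 : q {∫ x, id x ∂q}ᶜ = 0 := h1
  have h3 : q {∫ x, id x ∂q} = 0 := hac Real.volume_singleton
  have h4 := measure_univ_le_add_compl (μ := q) {∫ x, id x ∂q}
  rw [h2, h3, measure_univ] at h4
  simp at h4

theorem log_add_one_le {v t : ℝ} (hv : 0 < v) (ht : 0 < t) :
    Real.log v + 1 ≤ Real.log t + v / t := by
  have h := Real.log_le_sub_one_of_pos (div_pos hv ht)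
  rw [Real.log_div hv.ne' ht.ne'] at h
  linarith

theorem log_add_one_lt {v t : ℝ} (hv : 0 < v) (ht : 0 < t) (hne : t ≠ v) :
    Real.log v + 1 < Real.log t + v / t := by
  have h := Real.log_lt_sub_one_of_pos (div_pos hv ht)
    (fun h => hne ((div_eq_one_iff_eq ht.ne').1 h).symm)
  rw [Real.log_div hv.ne' ht.ne'] at h
  linarith

theorem isMinOn_klDiv_gaussianReal_iff {q : Measure ℝ} [IsProbabilityMeasure q]
    (hq : MemLp id 2 q) (hac : q ≪ volume) (hllr : Integrable (llr q volume) q) (m : ℝ)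
    {s : ℝ≥0} (hs : 0 < s) :
    IsMinOn (fun p : ℝ × ℝ≥0 => InformationTheory.klDiv q (gaussianReal p.1 (p.2 ^ 2)))
        {p | 0 < p.2} (m, s) ↔
      m = ∫ x, x ∂q ∧ (s : ℝ) ^ 2 = variance id q := by
  have hv := variance_id_pos hq hac
  have hle : ∀ (m' : ℝ) (s' : ℝ≥0), 0 < s' →
      (InformationTheory.klDiv q (gaussianReal m (s ^ 2))
        ≤ InformationTheory.klDiv q (gaussianReal m' (s' ^ 2)) ↔
      Real.log ((s : ℝ) ^ 2) + (variance id q + (m - ∫ x, x ∂q) ^ 2) / (s : ℝ) ^ 2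
        ≤ Real.log ((s' : ℝ) ^ 2)
          + (variance id q + (m' - ∫ x, x ∂q) ^ 2) / (s' : ℝ) ^ 2) := fun m' s' hs' => by
    rw [← ENNReal.toReal_le_toReal (klDiv_gaussianReal_ne_top hq hac hllr m hs)
      (klDiv_gaussianReal_ne_top hq hac hllr m' hs'),
      toReal_klDiv_gaussianReal hq hac hllr m hs, toReal_klDiv_gaussianReal hq hac hllr m' hs']
    constructor <;> intro h <;> linarith
  have hs2 : (0 : ℝ) < (s : ℝ) ^ 2 := pow_pos (NNReal.coe_pos.2 hs) 2
  rw [isMinOn_iff]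
  constructor
  · intro h
    -- Compare with the moment-matched Gaussian, where the parameter-dependent part is `log
    -- (variance id q) + 1`.
    have h1 := h (∫ x, x ∂q, NNReal.sqrt (variance id q).toNNReal)
      (NNReal.sqrt_pos.2 (Real.toNNReal_pos.2 hv))
    have hw : ((NNReal.sqrt (variance id q).toNNReal : ℝ≥0) : ℝ) ^ 2 = variance id q := by
      rw [← NNReal.coe_pow, NNReal.sq_sqrt, Real.coe_toNNReal _ hv.le]
    rw [hle _ _ (NNReal.sqrt_pos.2 (Real.toNNReal_pos.2 hv)), hw] at h1
    simp only [sub_self, zero_pow two_ne_zero, add_zero, div_self hv.ne', add_div] at h1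
    have h2 : 0 ≤ (m - ∫ x, x ∂q) ^ 2 / (s : ℝ) ^ 2 := by positivity
    have h3 : (s : ℝ) ^ 2 = variance id q := by
      by_contra hne
      linarith [log_add_one_lt hv hs2 hne]
    have h4 : (m - ∫ x, x ∂q) ^ 2 / (s : ℝ) ^ 2 = 0 := by
      linarith [log_add_one_le hv hs2]
    rw [div_eq_zero_iff, or_iff_left hs2.ne', pow_eq_zero_iff two_ne_zero, sub_eq_zero] at h4
    exact ⟨h4, h3⟩
  · rintro ⟨h1, h2⟩ p hp
    have hp2 : (0 : ℝ) < (p.2 : ℝ) ^ 2 := pow_pos (NNReal.coe_pos.2 hp) 2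
    refine (hle p.1 p.2 hp).2 ?_
    rw [h1, h2, sub_self, zero_pow two_ne_zero, add_zero, div_self hv.ne', add_div]
    have h3 : 0 ≤ (p.1 - ∫ x, x ∂q) ^ 2 / (p.2 : ℝ) ^ 2 := by positivity
    linarith [log_add_one_le hv hp2]

end QP

theorem mainTheorem5 (q : Measure ℝ) [IsProbabilityMeasure q] (hq : MemLp id 2 q) :
    -- the objective is the squared `L₂` distance of the quantile functions
    (∀ (m : ℝ) (s : ℝ≥0),
      (∀ y ∈ Ioo (0 : ℝ) 1, QP.quantile (gaussianReal m (s ^ 2)) y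
        = m + Real.sqrt 2 * s * QP.erfInv (2 * y - 1)) ∧
      IntervalIntegrable
        (fun y => (QP.quantile q y - QP.quantile (gaussianReal m (s ^ 2)) y) ^ 2) volume 0 1 ∧
      QP.wassersteinSq q (gaussianReal m (s ^ 2)) = ENNReal.ofReal
        (∫ y in (0 : ℝ)..1, (QP.quantile q y - QP.quantile (gaussianReal m (s ^ 2)) y) ^ 2)) ∧
    -- the two expressions for the optimal standard deviation exist, agree and are nonnegative
    IntervalIntegrable (fun y => QP.quantile q y * QP.erfInv (2 * y - 1)) volume 0 1 ∧
    Integrable (fun f => QP.expNegErfInvSq (2 * cdf q f - 1)) volume ∧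
    Real.sqrt 2 * (∫ y in (0 : ℝ)..1, QP.quantile q y * QP.erfInv (2 * y - 1))
      = 1 / Real.sqrt (2 * Real.pi) * ∫ f, QP.expNegErfInvSq (2 * cdf q f - 1) ∧
    0 ≤ Real.sqrt 2 * (∫ y in (0 : ℝ)..1, QP.quantile q y * QP.erfInv (2 * y - 1)) ∧
    -- the unique minimiser, point masses counted as Gaussians of standard deviation zero
    (∀ (μ : ℝ) (σ : ℝ≥0),
      IsMinOn (fun p : ℝ × ℝ≥0 => QP.wassersteinSq q (gaussianReal p.1 (p.2 ^ 2))) univ (μ, σ) ↔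
        μ = ∫ x, x ∂q ∧
        (σ : ℝ) = Real.sqrt 2 *
          ∫ y in (0 : ℝ)..1, QP.quantile q y * QP.erfInv (2 * y - 1)) ∧
    -- the unique minimiser among nondegenerate Gaussians, if `q` is not a point mass
    ((∀ a : ℝ, q ≠ Measure.dirac a) →
      0 < Real.sqrt 2 * (∫ y in (0 : ℝ)..1, QP.quantile q y * QP.erfInv (2 * y - 1)) ∧
      ∀ (μ : ℝ) (σ : ℝ≥0), 0 < σ →
        (IsMinOn (fun p : ℝ × ℝ≥0 => QP.wassersteinSq q (gaussianReal p.1 (p.2 ^ 2)))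
            {p | 0 < p.2} (μ, σ) ↔
          μ = ∫ x, x ∂q ∧
          (σ : ℝ) = Real.sqrt 2 *
            ∫ y in (0 : ℝ)..1, QP.quantile q y * QP.erfInv (2 * y - 1))) ∧
    -- expectation propagation: the Kullback-Leibler minimiser has the same mean `∫ x, x ∂q`,
    -- but matches the variance
    ((∃ (m : ℝ) (s : ℝ≥0), 0 < s ∧ InformationTheory.klDiv q (gaussianReal m (s ^ 2)) ≠ ⊤) →
      ∀ (μ : ℝ) (σ : ℝ≥0), 0 < σ →
        (IsMinOn (fun p : ℝ × ℝ≥0 => InformationTheory.klDiv q (gaussianReal p.1 (p.2 ^ 2)))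
            {p | 0 < p.2} (μ, σ) ↔
          μ = ∫ x, x ∂q ∧ (σ : ℝ) ^ 2 = variance id q)) := by
  simp only [QP.intervalIntegrable_iff_unif, QP.intervalIntegral_eq_unif]
  have hpos := QP.quantileSigma_nonneg hq
  refine ⟨fun m s => ⟨fun y hy => QP.quantile_gaussianReal m s hy, ?_, ?_⟩,
    QP.integrable_quantile_mul_erfInv hq, QP.integrable_expNegErfInvSq hq,
    QP.quantileSigma_eq hq, hpos,
    fun μ σ => QP.isMinOn_wassersteinSq_iff hq (mem_univ _) μ σ, fun hd => ?_, ?_⟩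
  · exact QP.integrable_sq_quantile_sub hq (memLp_id_gaussianReal' 2 ENNReal.ofNat_ne_top)
  · exact QP.wassersteinSq_eq_ofReal hq (memLp_id_gaussianReal' 2 ENNReal.ofNat_ne_top)
  · have hσ := QP.quantileSigma_pos hq hd
    exact ⟨hσ, fun μ σ _ => QP.isMinOn_wassersteinSq_iff hq (Real.toNNReal_pos.2 hσ) μ σ⟩
  · rintro ⟨m, s, hs, h⟩ μ σ hσ
    exact QP.isMinOn_klDiv_gaussianReal_iff hq
      (QP.absolutelyContinuous_of_klDiv_gaussianReal hs h)
      (QP.integrable_llr_of_klDiv_gaussianReal hq hs h) μ hσ
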